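/- Let $n\ge 1$ and let $\Omega\subset\mathbb R^n$ be an open, bounded, strictly convex domain with smooth boundary and with $0\in\Omega$. Let $$\mathcal C_0=\{u\in C^\infty(\overline\Omega): D^2u>0 \text{ in } \Omega,\ u=0 \text{ on } \partial\Omega\},$$ and for $u\in\mathcal C_0$ put $u^\star(x)=\langle x,\nabla u(x)\rangle-u(x)$. Let $k\in\mathbb R$ with $n+k+1>0$ and define, for $u\in\mathcal C_0$, $$H_{n+k}(u)=\frac1{n+k+1}\int_\Omega (u^\star)^k(-u)\det D^2u\,dx .$$ Then for every $u\in\mathcal C_0$ this integral and $\int_\Omega|u|^{n+k+1}\,dx$ converge, and there is a constant $c>0$, depending only on $n$, $k$ and $\Omega$, such that $$H_{n+k}(u)\ \ge\ c\int_\Omega |u|^{n+k+1}\,dx\qquad\text{for all }u\in\mathcal C_0 .$$ Consequently the invariant $$\underline\lambda_{n+k+1}(\Omega):=\inf_{u\in\mathcal C_0}\frac{(n+k+1)\,H_{n+k}(u)}{\int_\Omega|u|^{n+k+1}\,dx}\in[-\infty,+\infty]$$ (with $\inf\emptyset=+\infty$) is positive, and it gives the optimal constant: a real number $c$ satisfies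 $H_{n+k}(u)\ge c\int_\Omega|u|^{n+k+1}\,dx$ for all $u\in\mathcal C_0$ if and only if $(n+k+1)\,c\le\underline\lambda_{n+k+1}(\Omega)$. -/

import Mathlib

open MeasureTheory
open scoped ContDiff

/-- `Ω` has smooth boundary: near each boundary point, `Ω` is the sublevel set `{ρ < 0}` of a smooth
function `ρ` whose differential does not vanish at that point. -/
def HasSmoothBoundary {n : ℕ} (Ω : Set (EuclideanSpace ℝ (Fin n))) : Prop :=
  ∀ x ∈ frontier Ω, ∃ (U : Set (EuclideanSpace ℝ (Fin n))) (ρ : EuclideanSpace ℝ (Fin n) → ℝ),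
    IsOpen U ∧ x ∈ U ∧ ContDiffOn ℝ ∞ ρ U ∧ fderiv ℝ ρ x ≠ 0 ∧
      ∀ y ∈ U, (y ∈ Ω ↔ ρ y < 0)

/-- The Hessian matrix `D²u(x)` of second partial derivatives. -/
noncomputable def hessian {n : ℕ} (u : EuclideanSpace ℝ (Fin n) → ℝ)
    (x : EuclideanSpace ℝ (Fin n)) : Matrix (Fin n) (Fin n) ℝ :=
  Matrix.of fun i j =>
    iteratedFDeriv ℝ 2 u x ![EuclideanSpace.single i 1, EuclideanSpace.single j 1]

/-- `u⋆(x) = ⟨x, ∇u(x)⟩ - u(x)`. -/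
noncomputable def uStar {n : ℕ} (u : EuclideanSpace ℝ (Fin n) → ℝ)
    (x : EuclideanSpace ℝ (Fin n)) : ℝ :=
  inner ℝ x (gradient u x) - u x

/-- The class `𝒞₀` of functions that are smooth up to the boundary of `Ω`, have positive definite
Hessian in `Ω`, and vanish on the boundary. (Values outside `closure Ω` are irrelevant.) -/
def classC0 {n : ℕ} (Ω : Set (EuclideanSpace ℝ (Fin n))) :
    Set (EuclideanSpace ℝ (Fin n) → ℝ) :=
  {u | ContDiffOn ℝ ∞ u (closure Ω) ∧ (∀ x ∈ Ω, (hessian u x).PosDef) ∧ ∀ x ∈ frontier Ω, u x = 0}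

/-- The integrand `(u⋆)ᵏ (-u) det D²u`. -/
noncomputable def maIntegrand {n : ℕ} (k : ℝ) (u : EuclideanSpace ℝ (Fin n) → ℝ)
    (x : EuclideanSpace ℝ (Fin n)) : ℝ :=
  uStar u x ^ k * (-u x) * (hessian u x).det

/-- The generalized Monge-Ampère functional `H_{n+k}`. -/
noncomputable def maFunctional {n : ℕ} (Ω : Set (EuclideanSpace ℝ (Fin n))) (k : ℝ)
    (u : EuclideanSpace ℝ (Fin n) → ℝ) : ℝ :=
  1 / ((n : ℝ) + k + 1) * ∫ x in Ω, maIntegrand k u x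

/-- The invariant `λ_{n+k+1}(Ω)`: the infimum over `𝒞₀` of
`(n + k + 1) H_{n+k}(u) / ∫_Ω |u|^{n+k+1}`, as an extended real number
(with the usual convention that an infimum over the empty set is `+∞`). -/
noncomputable def lowerLambda {n : ℕ} (Ω : Set (EuclideanSpace ℝ (Fin n))) (k : ℝ) : EReal :=
  ⨅ u ∈ classC0 Ω,
    ((((n : ℝ) + k + 1) * maFunctional Ω k u / ∫ x in Ω, |u x| ^ ((n : ℝ) + k + 1) : ℝ) : EReal)

/-! Both sides are comparable to a power of m = -u(0). Fix balls of radii r and R about 0, one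
inside Ω and one containing it. Upper bound: u is convex and nonpositive, so |u| ≤ ((r+R)/r) m on Ω
(`ConvexOn.neg_le_of_ball_subset`), and the integral of |u|^(n+k+1) is at most a constant times
m^(n+k+1). Lower bound, in the manner of Alexandrov: the integrand is positive, so it may be
integrated only over A = {|∇u| < m/(2R)}. There -u ≥ m/2 and u⋆ lies between m and a multiple of m
(`classC0.bounds_of_gradient_mem_ball`), which controls (u⋆)^k for either sign of k. The gradient
maps A onto the ball of radius m/(2R), so det D²u has integral at least a constant times m^n over A
(`classC0.volume_ball_le_lintegral`). The product has order m^k · m · m^n. Dividing the two bounds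
eliminates m and leaves a constant depending only on n, k, r, R and the volume of Ω. -/

/-! ### Convexity from second derivatives. -/

theorem fderiv_fderiv_apply_self_eq_hessian {n : ℕ} (u : EuclideanSpace ℝ (Fin n) → ℝ)
    (x v : EuclideanSpace ℝ (Fin n)) :
    fderiv ℝ (fderiv ℝ u) x v v = v.ofLp ⬝ᵥ (hessian u x).mulVec v.ofLp := by
  have hv : v = ∑ i, v i • EuclideanSpace.single i (1 : ℝ) := by
    ext j
    simp [Pi.single_apply]
  conv_lhs => rw [hv]
  simp only [map_sum, map_smul, sum_apply, smul_apply,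
    smul_eq_mul, dotProduct, Matrix.mulVec, hessian, Matrix.of_apply, iteratedFDeriv_two_apply,
    Matrix.cons_val_zero, Matrix.cons_val_one, Finset.mul_sum]
  rw [Finset.sum_comm]
  exact Finset.sum_congr rfl fun i _ => Finset.sum_congr rfl fun j _ => by ring

theorem hasDerivAt_comp_lineMap {E F : Type*} [NormedAddCommGroup E] [NormedSpace ℝ E]
    [NormedAddCommGroup F] [NormedSpace ℝ F] {f : E → F} {x y : E} {t : ℝ}
    (hf : DifferentiableAt ℝ f (AffineMap.lineMap x y t)) :
    HasDerivAt (fun s : ℝ => f (AffineMap.lineMap x y s))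
      (fderiv ℝ f (AffineMap.lineMap x y t) (y - x)) t :=
  hf.hasFDerivAt.comp_hasDerivAt t AffineMap.hasDerivAt_lineMap

/-- A function whose second derivative is positive definite on an open convex set is strictly
convex there. -/
theorem strictConvexOn_of_fderiv_fderiv_pos {E : Type*} [NormedAddCommGroup E] [NormedSpace ℝ E]
    {Ω : Set E} {u : E → ℝ} (hΩo : IsOpen Ω) (hΩc : Convex ℝ Ω) (hu : ContDiffOn ℝ 2 u Ω)
    (hpos : ∀ x ∈ Ω, ∀ v ≠ 0, 0 < fderiv ℝ (fderiv ℝ u) x v v) : StrictConvexOn ℝ Ω u := by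
  refine ⟨hΩc, fun x hx y hy hxy a b ha hb hab => ?_⟩
  have hmem : ∀ t ∈ Set.Icc (0 : ℝ) 1, AffineMap.lineMap x y t ∈ Ω := fun t ht =>
    hΩc.segment_subset hx hy (segment_eq_image_lineMap ℝ x y ▸ Set.mem_image_of_mem _ ht)
  have hat : ∀ z ∈ Ω, ContDiffAt ℝ 2 u z := fun z hz => hu.contDiffAt (hΩo.mem_nhds hz)
  have hd1 : ∀ z ∈ Ω, DifferentiableAt ℝ u z := fun z hz =>
    (hat z hz).differentiableAt (by norm_num)
  have hd2 : ∀ z ∈ Ω, DifferentiableAt ℝ (fderiv ℝ u) z := fun z hz =>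
    ((hat z hz).fderiv_right (m := 1) (by norm_num)).differentiableAt (by norm_num)
  have hcont : Continuous fun t : ℝ => AffineMap.lineMap (k := ℝ) x y t :=
    AffineMap.lineMap_continuous
  have key : StrictConvexOn ℝ (Set.Icc (0 : ℝ) 1) fun t => u (AffineMap.lineMap x y t) := by
    refine strictConvexOn_of_deriv2_pos' (convex_Icc 0 1)
      (hu.continuousOn.comp hcont.continuousOn hmem) fun t ht => ?_
    have h1 : deriv (fun t => u (AffineMap.lineMap x y t)) =ᶠ[nhds t]
        fun t => fderiv ℝ u (AffineMap.lineMap x y t) (y - x) := by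
      filter_upwards [(hΩo.preimage hcont).mem_nhds (hmem t ht)] with s hs
      exact (hasDerivAt_comp_lineMap (hd1 _ hs)).deriv
    have h2 := (hasDerivAt_comp_lineMap (hd2 _ (hmem t ht))).clm_apply
      (hasDerivAt_const t (y - x))
    simp only [Function.iterate_succ, Function.iterate_zero, Function.comp_apply, id_eq]
    rw [h1.deriv_eq, h2.deriv]
    simpa using hpos _ (hmem t ht) (y - x) (sub_ne_zero.2 hxy.symm)
  have := key.2 (Set.left_mem_Icc.2 zero_le_one) (Set.right_mem_Icc.2 zero_le_one)
    zero_ne_one ha hb hab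
  simp only [smul_eq_mul, mul_zero, mul_one, zero_add, AffineMap.lineMap_apply_zero,
    AffineMap.lineMap_apply_one] at this
  rwa [AffineMap.lineMap_apply_module, ← hab, add_sub_cancel_right] at this

/-- A differentiable convex function lies above its tangent hyperplanes. -/
theorem ConvexOn.add_fderiv_le {E : Type*} [NormedAddCommGroup E] [NormedSpace ℝ E]
    {Ω : Set E} {u : E → ℝ} (hu : ConvexOn ℝ Ω u) {x y : E} (hx : x ∈ Ω) (hy : y ∈ Ω)
    (hd : DifferentiableAt ℝ u x) : u x + fderiv ℝ u x (y - x) ≤ u y := by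
  have hconv := hu.comp_affineMap (AffineMap.lineMap (k := ℝ) x y)
  have hd0 : HasDerivAt (u ∘ AffineMap.lineMap (k := ℝ) x y) (fderiv ℝ u x (y - x)) 0 := by
    have := hasDerivAt_comp_lineMap (f := u) (x := x) (y := y) (t := 0) (by simpa using hd)
    rw [AffineMap.lineMap_apply_zero] at this
    exact this
  have := hconv.le_slope_of_hasDerivAt (x := 0) (y := 1) (by simpa) (by simpa) one_pos hd0
  simp only [slope_def_field, Function.comp_apply, AffineMap.lineMap_apply_zero,
    AffineMap.lineMap_apply_one, sub_zero, div_one] at this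
  linarith

/-- A strictly convex function on an open subset of a nontrivial space has no interior maximum. -/
theorem StrictConvexOn.not_isMaxOn {E : Type*} [NormedAddCommGroup E] [NormedSpace ℝ E]
    [Nontrivial E] {Ω : Set E} {u : E → ℝ} (hΩo : IsOpen Ω) (hu : StrictConvexOn ℝ Ω u) {x : E}
    (hx : x ∈ Ω) : ¬ IsMaxOn u Ω x := by
  intro hmax
  obtain ⟨e, he⟩ := exists_ne (0 : E)
  have hmem : ∀ᶠ t in nhdsWithin (0 : ℝ) (Set.Ioi 0), x + t • e ∈ Ω ∧ x - t • e ∈ Ω := by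
    refine Filter.Eventually.filter_mono nhdsWithin_le_nhds (Filter.Eventually.and ?_ ?_)
    · exact (by fun_prop : Continuous fun t : ℝ => x + t • e).continuousAt.eventually_mem
        (hΩo.mem_nhds (by simpa using hx))
    · exact (by fun_prop : Continuous fun t : ℝ => x - t • e).continuousAt.eventually_mem
        (hΩo.mem_nhds (by simpa using hx))
  obtain ⟨t, ⟨h1, h2⟩, ht⟩ := (hmem.and self_mem_nhdsWithin).exists
  have hne : x + t • e ≠ x - t • e := by
    intro h
    have h3 : (2 * t) • e = 0 := by
      rw [two_mul, add_smul]
      calc t • e + t • e = (x + t • e) - (x - t • e) := by abel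
        _ = 0 := by rw [h, sub_self]
    rcases smul_eq_zero.1 h3 with h4 | h4
    · have : 0 < t := ht
      linarith
    · exact he h4
  have := hu.2 h1 h2 hne (half_pos one_pos) (half_pos one_pos) (add_halves 1)
  have hmid : (1 / 2 : ℝ) • (x + t • e) + (1 / 2 : ℝ) • (x - t • e) = x := by
    module
  rw [hmid] at this
  have h3 := hmax h1
  have h4 := hmax h2
  simp only [Set.mem_ofPred_eq, smul_eq_mul] at *
  linarith

/-! ### Sign, gradient map and integrability for functions in the class. -/

section ClassC0

variable {n : ℕ} {Ω : Set (EuclideanSpace ℝ (Fin n))} {u : EuclideanSpace ℝ (Fin n) → ℝ}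

theorem classC0.contDiffOn (hu : u ∈ classC0 Ω) : ContDiffOn ℝ ∞ u Ω :=
  hu.1.mono subset_closure

theorem classC0.contDiffAt (hΩo : IsOpen Ω) (hu : u ∈ classC0 Ω) {x} (hx : x ∈ Ω) :
    ContDiffAt ℝ ∞ u x :=
  (classC0.contDiffOn hu).contDiffAt (hΩo.mem_nhds hx)

theorem classC0.differentiableAt (hΩo : IsOpen Ω) (hu : u ∈ classC0 Ω) {x} (hx : x ∈ Ω) :
    DifferentiableAt ℝ u x :=
  (classC0.contDiffAt hΩo hu hx).differentiableAt (by simp)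

theorem classC0.differentiableAt_fderiv (hΩo : IsOpen Ω) (hu : u ∈ classC0 Ω) {x} (hx : x ∈ Ω) :
    DifferentiableAt ℝ (fderiv ℝ u) x :=
  ((classC0.contDiffAt hΩo hu hx).fderiv_right (m := 1) (by norm_cast)).differentiableAt
    (by norm_num)

theorem classC0.strictConvexOn (hΩo : IsOpen Ω) (hΩc : Convex ℝ Ω) (hu : u ∈ classC0 Ω) :
    StrictConvexOn ℝ Ω u := by
  refine strictConvexOn_of_fderiv_fderiv_pos hΩo hΩc
    ((classC0.contDiffOn hu).of_le (by norm_cast)) fun x hx v hv => ?_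
  rw [fderiv_fderiv_apply_self_eq_hessian]
  have := (hu.2.1 x hx).dotProduct_mulVec_pos (x := v.ofLp)
    (by simpa using hv)
  simpa using this

/-- Strict convexity excludes an interior maximum, so the maximum over the closure is the boundary
value 0, and it is not attained inside. Since n ≥ 1, the space is nontrivial. -/
theorem classC0.neg (hn : 1 ≤ n) (hΩo : IsOpen Ω) (hΩb : Bornology.IsBounded Ω)
    (hΩc : Convex ℝ Ω) (hu : u ∈ classC0 Ω) {x} (hx : x ∈ Ω) : u x < 0 := by
  have : Nonempty (Fin n) := ⟨⟨0, hn⟩⟩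
  have hsc := classC0.strictConvexOn hΩo hΩc hu
  obtain ⟨z, hz, hzmax⟩ := hΩb.isCompact_closure.exists_isMaxOn ⟨x, subset_closure hx⟩
    hu.1.continuousOn
  have hzf : z ∈ frontier Ω := by
    rw [hΩo.frontier_eq]
    exact ⟨hz, fun hzΩ => hsc.not_isMaxOn hΩo hzΩ (hzmax.on_subset subset_closure)⟩
  have h0 : ∀ y ∈ Ω, u y ≤ 0 := fun y hy => hu.2.2 z hzf ▸ hzmax (subset_closure hy)
  refine lt_of_le_of_ne (h0 x hx) fun h => hsc.not_isMaxOn hΩo hx fun y hy => ?_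
  exact (h0 y hy).trans h.ge

theorem uStar_eq_fderiv (u : EuclideanSpace ℝ (Fin n) → ℝ) (x : EuclideanSpace ℝ (Fin n)) :
    uStar u x = fderiv ℝ u x x - u x := by
  rw [uStar, real_inner_comm, gradient, InnerProductSpace.toDual_symm_apply]

/-- The tangent plane of u at x takes the value -u⋆(x) at the origin and lies below the graph. -/
theorem classC0.neg_apply_zero_le_uStar (hΩo : IsOpen Ω) (hΩc : Convex ℝ Ω) (h0 : 0 ∈ Ω)
    (hu : u ∈ classC0 Ω) {x} (hx : x ∈ Ω) : -u 0 ≤ uStar u x := by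
  have := (classC0.strictConvexOn hΩo hΩc hu).convexOn.add_fderiv_le hx h0
    (classC0.differentiableAt hΩo hu hx)
  rw [zero_sub, map_neg] at this
  rw [uStar_eq_fderiv]
  linarith

/-- A convex function that is nonpositive on a set pinched between two balls around the origin
is bounded by its value at the origin. -/
theorem ConvexOn.neg_le_of_ball_subset {E : Type*} [NormedAddCommGroup E] [NormedSpace ℝ E]
    {Ω : Set E} {u : E → ℝ} {r R : ℝ} (hr : 0 < r) (hR : 0 < R) (hu : ConvexOn ℝ Ω u)
    (hneg : ∀ x ∈ Ω, u x ≤ 0) (hball : Metric.closedBall 0 r ⊆ Ω)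
    (hΩR : Ω ⊆ Metric.closedBall 0 R) {x : E} (hx : x ∈ Ω) :
    -u x ≤ (r + R) / r * -u 0 := by
  have hxR : ‖x‖ ≤ R := by simpa using hΩR hx
  -- The origin is a convex combination of x and this opposite point, where u ≤ 0.
  have hy : (-(r / R)) • x ∈ Ω := hball <| by
    rw [mem_closedBall_zero_iff, norm_smul, norm_neg, Real.norm_of_nonneg (by positivity)]
    calc r / R * ‖x‖ ≤ r / R * R := by gcongr
      _ = r := by field_simp
  have ha : 0 < r / (r + R) := by positivity
  have hb : 0 < R / (r + R) := by positivity
  have h := hu.2 hx hy ha.le hb.le (by field_simp)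
  have hz : (r / (r + R)) • x + (R / (r + R)) • (-(r / R)) • x = 0 := by
    rw [smul_smul, ← add_smul, show r / (r + R) + R / (r + R) * -(r / R) = 0 by field_simp; ring,
      zero_smul]
  rw [hz, smul_eq_mul, smul_eq_mul] at h
  have h2 : R / (r + R) * u (-(r / R) • x) ≤ 0 :=
    mul_nonpos_of_nonneg_of_nonpos hb.le (hneg _ hy)
  have h3 : r / (r + R) * -u x ≤ -u 0 := by linarith
  calc -u x = (r + R) / r * (r / (r + R) * -u x) := by field_simp
    _ ≤ (r + R) / r * -u 0 := by gcongr

/-- The inverse of the Riesz isomorphism of a real Hilbert space, as a linear map. -/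
noncomputable def rieszSymm (E : Type*) [NormedAddCommGroup E] [InnerProductSpace ℝ E]
    [CompleteSpace E] : StrongDual ℝ E →L[ℝ] E where
  toFun := (InnerProductSpace.toDual ℝ E).symm
  map_add' := map_add _
  map_smul' c y := by simp
  cont := (InnerProductSpace.toDual ℝ E).symm.continuous

/-- The derivative of the gradient, as an endomorphism. -/
noncomputable def fderivGradient (u : EuclideanSpace ℝ (Fin n) → ℝ)
    (x : EuclideanSpace ℝ (Fin n)) : EuclideanSpace ℝ (Fin n) →L[ℝ] EuclideanSpace ℝ (Fin n) :=
  rieszSymm _ ∘L fderiv ℝ (fderiv ℝ u) x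

theorem inner_fderivGradient (u : EuclideanSpace ℝ (Fin n) → ℝ)
    (x v w : EuclideanSpace ℝ (Fin n)) :
    inner ℝ (fderivGradient u x v) w = fderiv ℝ (fderiv ℝ u) x v w :=
  InnerProductSpace.toDual_symm_apply (𝕜 := ℝ)

theorem classC0.hasFDerivAt_gradient (hΩo : IsOpen Ω) (hu : u ∈ classC0 Ω) {x} (hx : x ∈ Ω) :
    HasFDerivAt (gradient u) (fderivGradient u x) x :=
  (rieszSymm _).hasFDerivAt.comp x
    (classC0.differentiableAt_fderiv hΩo hu hx).hasFDerivAt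

theorem det_fderivGradient (u : EuclideanSpace ℝ (Fin n) → ℝ) (x : EuclideanSpace ℝ (Fin n)) :
    (fderivGradient u x).det = (hessian u x).det := by
  -- The transpose matches the index order of the two matrices, so symmetry of the Hessian is not
  -- needed.
  rw [ContinuousLinearMap.det,
    ← LinearMap.det_toMatrix (EuclideanSpace.basisFun (Fin n) ℝ).toBasis, ← Matrix.det_transpose]
  congr 1
  ext i j
  rw [Matrix.transpose_apply, LinearMap.toMatrix_apply]
  simp only [hessian, Matrix.of_apply, iteratedFDeriv_two_apply, Matrix.cons_val_zero,
    Matrix.cons_val_one, ← inner_fderivGradient]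
  simp [EuclideanSpace.inner_single_right]

theorem classC0.continuousOn_gradient (hΩo : IsOpen Ω) (hu : u ∈ classC0 Ω) :
    ContinuousOn (gradient u) Ω := fun _ hx =>
  (classC0.hasFDerivAt_gradient hΩo hu hx).continuousAt.continuousWithinAt

/-- Minimise u - ⟨p, ·⟩ over the closure. For small p the tilt cannot push the minimiser to the
boundary, and at an interior minimiser the gradient is p. -/
theorem classC0.ball_subset_gradient_image (hn : 1 ≤ n) (hΩo : IsOpen Ω)
    (hΩb : Bornology.IsBounded Ω) (hΩc : Convex ℝ Ω) (h0 : 0 ∈ Ω) (hu : u ∈ classC0 Ω)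
    {R : ℝ} (hR : 0 < R) (hΩR : Ω ⊆ Metric.closedBall 0 R) :
    Metric.ball 0 (-u 0 / (2 * R)) ⊆
      gradient u '' (Ω ∩ gradient u ⁻¹' Metric.ball 0 (-u 0 / (2 * R))) := by
  intro p hp
  have hm := classC0.neg hn hΩo hΩb hΩc hu h0
  have hpn : ‖p‖ < -u 0 / (2 * R) := by simpa using hp
  obtain ⟨z, hz, hzmin⟩ := hΩb.isCompact_closure.exists_isMinOn
    (f := fun x => u x - inner ℝ p x) ⟨0, subset_closure h0⟩
    (hu.1.continuousOn.sub (by fun_prop))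
  have hzR : ‖z‖ ≤ R := by
    simpa using Metric.isClosed_closedBall.closure_subset_iff.2 hΩR hz
  -- Comparison with the origin gives u(z) ≤ u(0) + ⟨p, z⟩ ≤ u(0)/2; the factor 2 in the radius
  -- serves this.
  have hzneg : u z < 0 := by
    have h1 : u z - inner ℝ p z ≤ u 0 - inner ℝ p 0 := hzmin (subset_closure h0)
    rw [inner_zero_right] at h1
    have h2 : inner ℝ p z ≤ ‖p‖ * ‖z‖ := real_inner_le_norm p z
    have h3 : ‖p‖ * ‖z‖ ≤ -u 0 / (2 * R) * R :=
      mul_le_mul hpn.le hzR (norm_nonneg z) ((norm_nonneg p).trans hpn.le)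
    have h4 : -u 0 / (2 * R) * R = -u 0 / 2 := by field_simp
    linarith
  have hzΩ : z ∈ Ω := by
    by_contra h
    exact hzneg.ne (hu.2.2 z (hΩo.frontier_eq ▸ ⟨hz, h⟩))
  have hloc : IsLocalMin (fun x => u x - inner ℝ p x) z :=
    (hzmin.on_subset subset_closure).isLocalMin (hΩo.mem_nhds hzΩ)
  have hder : HasFDerivAt (fun x => u x - inner ℝ p x) (fderiv ℝ u z - innerSL ℝ p) z :=
    (classC0.differentiableAt hΩo hu hzΩ).hasFDerivAt.sub (innerSL ℝ p).hasFDerivAt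
  have hgrad : gradient u z = p := by
    rw [gradient, sub_eq_zero.1 (hloc.hasFDerivAt_eq_zero hder)]
    exact (InnerProductSpace.toDual ℝ _).symm_apply_apply p
  exact ⟨z, ⟨hzΩ, by simpa [hgrad] using hp⟩, hgrad⟩

/-- The volume of an image is at most the integral of |det| of the derivative; this direction needs
no injectivity of the gradient. -/
theorem classC0.volume_ball_le_lintegral (hn : 1 ≤ n) (hΩo : IsOpen Ω)
    (hΩb : Bornology.IsBounded Ω) (hΩc : Convex ℝ Ω) (h0 : 0 ∈ Ω) (hu : u ∈ classC0 Ω)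
    {R : ℝ} (hR : 0 < R) (hΩR : Ω ⊆ Metric.closedBall 0 R) :
    volume (Metric.ball (0 : EuclideanSpace ℝ (Fin n)) (-u 0 / (2 * R))) ≤
      ∫⁻ x in Ω ∩ gradient u ⁻¹' Metric.ball 0 (-u 0 / (2 * R)),
        ENNReal.ofReal (hessian u x).det := by
  have hA : IsOpen (Ω ∩ gradient u ⁻¹' Metric.ball 0 (-u 0 / (2 * R))) :=
    (classC0.continuousOn_gradient hΩo hu).isOpen_inter_preimage hΩo Metric.isOpen_ball
  refine (measure_mono (classC0.ball_subset_gradient_image hn hΩo hΩb hΩc h0 hu hR hΩR)).trans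
    ((addHaar_image_le_lintegral_abs_det_fderiv volume hA.measurableSet fun x hx =>
      (classC0.hasFDerivAt_gradient hΩo hu hx.1).hasFDerivWithinAt).trans_eq
      (setLIntegral_congr_fun hA.measurableSet fun x hx => ?_))
  simp only [det_fderivGradient]
  rw [abs_of_pos (hu.2.1 x hx.1).det_pos]

/-- The bounds on `{x ∈ Ω | ‖∇u(x)‖ < -u(0) / (2R)}`. -/
theorem classC0.bounds_of_gradient_mem_ball (hΩo : IsOpen Ω) (hΩc : Convex ℝ Ω) (h0 : 0 ∈ Ω)
    (hu : u ∈ classC0 Ω) {R : ℝ} (hR : 0 < R) (hΩR : Ω ⊆ Metric.closedBall 0 R) {x}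
    (hx : x ∈ Ω ∩ gradient u ⁻¹' Metric.ball 0 (-u 0 / (2 * R))) :
    -u 0 / 2 ≤ -u x ∧ uStar u x ≤ -u 0 / 2 - u x := by
  have hxR : ‖x‖ ≤ R := by simpa using hΩR hx.1
  have hg : ‖gradient u x‖ < -u 0 / (2 * R) := by simpa using hx.2
  have h1 := abs_real_inner_le_norm x (gradient u x)
  have h2 : ‖x‖ * ‖gradient u x‖ ≤ R * (-u 0 / (2 * R)) := by gcongr
  have h3 : R * (-u 0 / (2 * R)) = -u 0 / 2 := by field_simp
  have h4 := abs_le.1 (h1.trans (h2.trans_eq h3))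
  have h5 := classC0.neg_apply_zero_le_uStar hΩo hΩc h0 hu hx.1
  simp only [uStar] at *
  constructor <;> linarith [h4.1, h4.2]

/-- The integrand extends continuously to the compact closure, hence is integrable. -/
theorem classC0.integrableOn (hΩo : IsOpen Ω)
    (hΩb : Bornology.IsBounded Ω) (hΩc : Convex ℝ Ω) (h0 : 0 ∈ Ω) (hu : u ∈ classC0 Ω)
    (hu0 : u 0 < 0) (k : ℝ) : IntegrableOn (maIntegrand k u) Ω := by
  have hcl : ∀ x ∈ Ω, closure Ω ∈ nhds x := fun x hx =>
    Filter.mem_of_superset (hΩo.mem_nhds hx) subset_closure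
  have hud : UniqueDiffOn ℝ (closure Ω) := uniqueDiffOn_convex hΩc.closure
    ⟨0, mem_interior_iff_mem_nhds.2 (hcl 0 h0)⟩
  have hcu := hu.1.continuousOn
  -- Derivatives within the closure are used because u is arbitrary outside it; they agree with the
  -- ordinary ones on Ω.
  have hc1 : ContinuousOn (fun x => fderivWithin ℝ u (closure Ω) x x - u x) (closure Ω) :=
    ((hu.1.continuousOn_fderivWithin hud (by simp)).clm_apply continuousOn_id).sub hcu
  have hc2 : ContinuousOn (iteratedFDerivWithin ℝ 2 u (closure Ω)) (closure Ω) :=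
    hu.1.continuousOn_iteratedFDerivWithin (by norm_cast) hud
  have hc3 : ContinuousOn (fun x => (Matrix.of fun i j : Fin n =>
      iteratedFDerivWithin ℝ 2 u (closure Ω) x
        ![EuclideanSpace.single i 1, EuclideanSpace.single j 1]).det) (closure Ω) := by
    simp only [Matrix.det_apply, Matrix.of_apply]
    refine continuousOn_finsetSum _ fun σ _ => (continuousOn_finsetProd _ fun i _ => ?_).const_smul _
    exact (ContinuousMultilinearMap.apply ℝ (fun _ : Fin 2 => EuclideanSpace ℝ (Fin n)) ℝ
      ![EuclideanSpace.single (σ i) 1, EuclideanSpace.single i 1]).continuous.comp_continuousOn hc2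
  have he1 : ∀ x ∈ Ω, uStar u x = fderivWithin ℝ u (closure Ω) x x - u x := fun x hx => by
    rw [uStar_eq_fderiv, fderivWithin_of_mem_nhds (hcl x hx)]
  -- The positive lower bound passes to the boundary by continuity, so the power stays continuous
  -- for negative k.
  have hpos : ∀ x ∈ closure Ω, -u 0 ≤ fderivWithin ℝ u (closure Ω) x x - u x := fun x hx =>
    ContinuousWithinAt.closure_le hx continuousWithinAt_const
      ((hc1 x hx).mono subset_closure) fun y hy =>
        (classC0.neg_apply_zero_le_uStar hΩo hΩc h0 hu hy).trans_eq (he1 y hy)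
  have hcont := ((hc1.rpow_const (p := k) fun x hx =>
    Or.inl ((neg_pos.2 hu0).trans_le (hpos x hx)).ne').mul hcu.neg).mul hc3
  refine ((hcont.integrableOn_compact hΩb.isCompact_closure).mono_set
    subset_closure).congr_fun (fun x hx => ?_) hΩo.measurableSet
  simp only [maIntegrand, hessian, he1 x hx, Pi.neg_apply, Pi.mul_apply]
  rw [iteratedFDerivWithin_eq_iteratedFDeriv hud
    ((classC0.contDiffAt hΩo hu hx).of_le (by norm_cast)) (subset_closure hx)]

theorem classC0.integrableOn_abs_rpow (hΩb : Bornology.IsBounded Ω) (hu : u ∈ classC0 Ω) {p : ℝ}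
    (hp : 0 ≤ p) : IntegrableOn (fun x => |u x| ^ p) Ω :=
  ((hu.1.continuousOn.abs.rpow_const fun _ _ => Or.inr hp).integrableOn_compact
    hΩb.isCompact_closure).mono_set subset_closure

end ClassC0

/-! ### Comparison with powers of -u(0), and the optimal constant. -/

/-- For k ≥ 0 the lower bound on t decides, for k ≤ 0 the upper one; the minimum covers both signs.
-/
theorem min_one_rpow_mul_rpow_le {m K t k : ℝ} (hm : 0 < m) (h1 : m ≤ t) (h2 : t ≤ K * m) :
    min 1 (K ^ k) * m ^ k ≤ t ^ k := by
  have hK : 0 < K := pos_of_mul_pos_left (hm.trans_le (h1.trans h2)) hm.le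
  rcases le_total 0 k with hk | hk
  · calc min 1 (K ^ k) * m ^ k ≤ 1 * m ^ k := by gcongr; exact min_le_left _ _
      _ = m ^ k := one_mul _
      _ ≤ t ^ k := by gcongr
  · calc min 1 (K ^ k) * m ^ k ≤ K ^ k * m ^ k := by gcongr; exact min_le_right _ _
      _ = (K * m) ^ k := (Real.mul_rpow hK.le hm.le).symm
      _ ≤ t ^ k := Real.rpow_le_rpow_of_nonpos (hm.trans_le h1) h2 hk

section ClassC0

variable {n : ℕ} {Ω : Set (EuclideanSpace ℝ (Fin n))} {u : EuclideanSpace ℝ (Fin n) → ℝ}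

theorem classC0.maIntegrand_pos (hn : 1 ≤ n) (hΩo : IsOpen Ω)
    (hΩb : Bornology.IsBounded Ω) (hΩc : Convex ℝ Ω) (h0 : 0 ∈ Ω) (hu : u ∈ classC0 Ω) (k : ℝ)
    {x} (hx : x ∈ Ω) : 0 < maIntegrand k u x := by
  have hm := classC0.neg hn hΩo hΩb hΩc hu h0
  have hs := classC0.neg_apply_zero_le_uStar hΩo hΩc h0 hu hx
  have hux := classC0.neg hn hΩo hΩb hΩc hu hx
  exact mul_pos (mul_pos (Real.rpow_pos_of_pos (by linarith) k) (by linarith))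
    (hu.2.1 x hx).det_pos

theorem classC0.le_integral_maIntegrand (hn : 1 ≤ n) (hΩo : IsOpen Ω)
    (hΩb : Bornology.IsBounded Ω) (hΩc : Convex ℝ Ω) (h0 : 0 ∈ Ω) (hu : u ∈ classC0 Ω) (k : ℝ)
    {r R : ℝ} (hr : 0 < r) (hR : 0 < R) (hball : Metric.closedBall 0 r ⊆ Ω)
    (hΩR : Ω ⊆ Metric.closedBall 0 R) :
    min 1 ((1 / 2 + (r + R) / r) ^ k) / 2 / (2 * R) ^ n *
        volume.real (Metric.ball (0 : EuclideanSpace ℝ (Fin n)) 1) * (-u 0) ^ ((n : ℝ) + k + 1) ≤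
      ∫ x in Ω, maIntegrand k u x := by
  -- On A, u⋆ ≤ m/2 - u(x): the 1/2 comes from the gradient term and (r+R)/r from the bound on
  -- -u(x).
  set K := 1 / 2 + (r + R) / r
  set m := -u 0 with hm_def
  set A := Ω ∩ gradient u ⁻¹' Metric.ball 0 (m / (2 * R))
  have hm : 0 < m := neg_pos.2 (classC0.neg hn hΩo hΩb hΩc hu h0)
  have hK : 0 < K := by positivity
  have hA : MeasurableSet A := ((classC0.continuousOn_gradient hΩo hu).isOpen_inter_preimage hΩo
    Metric.isOpen_ball).measurableSet
  have hint := classC0.integrableOn hΩo hΩb hΩc h0 hu (by linarith) k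
  have hpos : ∀ x ∈ Ω, 0 < maIntegrand k u x := fun x hx =>
    classC0.maIntegrand_pos hn hΩo hΩb hΩc h0 hu k hx
  have hB : 0 ≤ min 1 (K ^ k) * m ^ k * (m / 2) := by positivity
  have hpt : ∀ x ∈ A, min 1 (K ^ k) * m ^ k * (m / 2) * (hessian u x).det ≤
      maIntegrand k u x := fun x hx => by
    obtain ⟨h1, h2⟩ := classC0.bounds_of_gradient_mem_ball hΩo hΩc h0 hu hR hΩR hx
    have h3 := (classC0.strictConvexOn hΩo hΩc hu).convexOn.neg_le_of_ball_subset hr hR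
      (fun y hy => (classC0.neg hn hΩo hΩb hΩc hu hy).le) hball hΩR hx.1
    have h4 := classC0.neg_apply_zero_le_uStar hΩo hΩc h0 hu hx.1
    have h5 : uStar u x ≤ K * m := by
      rw [add_mul]
      linarith
    have h6 := min_one_rpow_mul_rpow_le (k := k) hm h4 h5
    exact mul_le_mul_of_nonneg_right (mul_le_mul h6 h1 (by positivity)
      (Real.rpow_nonneg (hm.le.trans h4) k)) (hu.2.1 x hx.1).det_pos.le
  have hle : ENNReal.ofReal (min 1 (K ^ k) * m ^ k * (m / 2)) *
      volume (Metric.ball (0 : EuclideanSpace ℝ (Fin n)) (m / (2 * R))) ≤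
      ENNReal.ofReal (∫ x in Ω, maIntegrand k u x) :=
    calc _ ≤ ENNReal.ofReal (min 1 (K ^ k) * m ^ k * (m / 2)) *
          ∫⁻ x in A, ENNReal.ofReal (hessian u x).det := by
          gcongr
          exact classC0.volume_ball_le_lintegral hn hΩo hΩb hΩc h0 hu hR hΩR
      _ = ∫⁻ x in A, ENNReal.ofReal (min 1 (K ^ k) * m ^ k * (m / 2) * (hessian u x).det) := by
          rw [← lintegral_const_mul' _ _ ENNReal.ofReal_ne_top]
          simp only [ENNReal.ofReal_mul hB]
      _ ≤ ∫⁻ x in A, ENNReal.ofReal (maIntegrand k u x) :=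
          setLIntegral_mono' hA fun x hx => ENNReal.ofReal_le_ofReal (hpt x hx)
      _ ≤ ∫⁻ x in Ω, ENNReal.ofReal (maIntegrand k u x) :=
          lintegral_mono_set Set.inter_subset_left
      _ = _ := (ofReal_integral_eq_lintegral_ofReal hint
          (ae_restrict_of_forall_mem hΩo.measurableSet fun x hx => (hpos x hx).le)).symm
  -- Scaling of the ball volume supplies the factor (m/(2R))^n.
  rw [Measure.addHaar_ball_of_pos _ _ (by positivity), finrank_euclideanSpace_fin] at hle
  have hreal := ENNReal.toReal_mono ENNReal.ofReal_ne_top hle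
  rw [ENNReal.toReal_mul, ENNReal.toReal_mul, ENNReal.toReal_ofReal hB,
    ENNReal.toReal_ofReal (by positivity), ENNReal.toReal_ofReal
      (setIntegral_nonneg hΩo.measurableSet fun x hx => (hpos x hx).le)] at hreal
  refine Eq.trans_le ?_ hreal
  rw [Real.rpow_add hm, Real.rpow_add hm, Real.rpow_natCast, Real.rpow_one, div_pow,
    measureReal_def]
  ring

theorem classC0.integral_abs_rpow_le (hn : 1 ≤ n) (hΩo : IsOpen Ω)
    (hΩb : Bornology.IsBounded Ω) (hΩc : Convex ℝ Ω) (h0 : 0 ∈ Ω) (hu : u ∈ classC0 Ω) {p : ℝ}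
    (hp : 0 ≤ p) {r R : ℝ} (hr : 0 < r) (hR : 0 < R) (hball : Metric.closedBall 0 r ⊆ Ω)
    (hΩR : Ω ⊆ Metric.closedBall 0 R) :
    ∫ x in Ω, |u x| ^ p ≤ ((r + R) / r) ^ p * volume.real Ω * (-u 0) ^ p := by
  have hm := classC0.neg hn hΩo hΩb hΩc hu h0
  calc ∫ x in Ω, |u x| ^ p ≤ ∫ _ in Ω, ((r + R) / r * -u 0) ^ p := by
        refine setIntegral_mono_on (classC0.integrableOn_abs_rpow hΩb hu hp)
          (integrableOn_const hΩb.measure_lt_top.ne) hΩo.measurableSet fun x hx => ?_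
        rw [abs_of_neg (classC0.neg hn hΩo hΩb hΩc hu hx)]
        exact Real.rpow_le_rpow (neg_nonneg.2 (classC0.neg hn hΩo hΩb hΩc hu hx).le)
          ((classC0.strictConvexOn hΩo hΩc hu).convexOn.neg_le_of_ball_subset hr hR
            (fun y hy => (classC0.neg hn hΩo hΩb hΩc hu hy).le) hball hΩR hx) hp
    _ = _ := by
        rw [setIntegral_const, Real.mul_rpow (by positivity) (by linarith), smul_eq_mul]
        ring

/-- This makes the quotient defining `lowerLambda` a genuine one, so the denominator can be cleared.
-/
theorem classC0.integral_abs_rpow_pos (hn : 1 ≤ n) (hΩo : IsOpen Ω)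
    (hΩb : Bornology.IsBounded Ω) (hΩc : Convex ℝ Ω) (h0 : 0 ∈ Ω) (hu : u ∈ classC0 Ω) {p : ℝ}
    (hp : 0 ≤ p) : 0 < ∫ x in Ω, |u x| ^ p := by
  have hpos : ∀ x ∈ Ω, 0 < |u x| ^ p := fun x hx =>
    Real.rpow_pos_of_pos (abs_pos.2 (classC0.neg hn hΩo hΩb hΩc hu hx).ne) p
  rw [setIntegral_pos_iff_support_of_nonneg_ae
    (ae_restrict_of_forall_mem hΩo.measurableSet fun x hx => (hpos x hx).le)
    (classC0.integrableOn_abs_rpow hΩb hu hp)]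
  exact (hΩo.measure_pos volume ⟨0, h0⟩).trans_le
    (measure_mono fun x hx => ⟨(hpos x hx).ne', hx⟩)

/-- The Sobolev type inequality for the generalized Monge-Ampère functional. -/
theorem exists_mul_integral_abs_rpow_le_maFunctional (hn : 1 ≤ n) {k : ℝ}
    (hk : 0 < (n : ℝ) + k + 1) (hΩo : IsOpen Ω) (hΩb : Bornology.IsBounded Ω)
    (hΩc : Convex ℝ Ω) (h0 : 0 ∈ Ω) :
    ∃ c : ℝ, 0 < c ∧ ∀ u ∈ classC0 Ω,
      c * ∫ x in Ω, |u x| ^ ((n : ℝ) + k + 1) ≤ maFunctional Ω k u := by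
  obtain ⟨r, hr, hball⟩ := Metric.nhds_basis_closedBall.mem_iff.1 (hΩo.mem_nhds h0)
  obtain ⟨R, hR, hΩR⟩ := hΩb.subset_closedBall_lt 0 0
  set D := min 1 ((1 / 2 + (r + R) / r) ^ k) / 2 / (2 * R) ^ n *
    volume.real (Metric.ball (0 : EuclideanSpace ℝ (Fin n)) 1) with hD_def
  set V := ((r + R) / r) ^ ((n : ℝ) + k + 1) * volume.real Ω with hV_def
  have hω : 0 < volume.real (Metric.ball (0 : EuclideanSpace ℝ (Fin n)) 1) :=
    ENNReal.toReal_pos (Metric.measure_ball_pos _ _ one_pos).ne' measure_ball_lt_top.ne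
  have hD : 0 < D := by positivity
  have hV : 0 < V := mul_pos (by positivity)
    (ENNReal.toReal_pos (hΩo.measure_pos volume ⟨0, h0⟩).ne' hΩb.measure_lt_top.ne)
  refine ⟨1 / ((n : ℝ) + k + 1) * (D / V), by positivity, fun u hu => ?_⟩
  rw [maFunctional, mul_assoc]
  gcongr
  calc D / V * ∫ x in Ω, |u x| ^ ((n : ℝ) + k + 1)
      ≤ D / V * (V * (-u 0) ^ ((n : ℝ) + k + 1)) := by
        gcongr
        exact classC0.integral_abs_rpow_le hn hΩo hΩb hΩc h0 hu hk.le hr hR hball hΩR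
    _ = D * (-u 0) ^ ((n : ℝ) + k + 1) := by field_simp
    _ ≤ _ := classC0.le_integral_maIntegrand hn hΩo hΩb hΩc h0 hu k hr hR hball hΩR

/-- `lowerLambda` gives the optimal constant. -/
theorem mul_integral_abs_rpow_le_maFunctional_iff (hn : 1 ≤ n) {k : ℝ}
    (hk : 0 < (n : ℝ) + k + 1) (hΩo : IsOpen Ω) (hΩb : Bornology.IsBounded Ω)
    (hΩc : Convex ℝ Ω) (h0 : 0 ∈ Ω) (c : ℝ) :
    (∀ u ∈ classC0 Ω, c * ∫ x in Ω, |u x| ^ ((n : ℝ) + k + 1) ≤ maFunctional Ω k u) ↔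
      (((((n : ℝ) + k + 1) * c : ℝ)) : EReal) ≤ lowerLambda Ω k := by
  rw [lowerLambda, le_iInf₂_iff]
  refine forall₂_congr fun u hu => ?_
  rw [EReal.coe_le_coe_iff,
    le_div_iff₀ (classC0.integral_abs_rpow_pos hn hΩo hΩb hΩc h0 hu hk.le), mul_assoc,
    mul_le_mul_iff_right₀ hk]

end ClassC0

theorem mainTheorem4 (n : ℕ) (hn : 1 ≤ n) (k : ℝ) (hk : 0 < (n : ℝ) + k + 1)
    (Ω : Set (EuclideanSpace ℝ (Fin n))) (hΩo : IsOpen Ω) (hΩb : Bornology.IsBounded Ω)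
    (hΩc : Convex ℝ Ω) (hΩsc : StrictConvex ℝ (closure Ω)) (hΩs : HasSmoothBoundary Ω)
    (hΩ0 : (0 : EuclideanSpace ℝ (Fin n)) ∈ Ω) :
    -- the integrals involved converge
    (∀ u ∈ classC0 Ω, IntegrableOn (maIntegrand k u) Ω ∧
      IntegrableOn (fun x => |u x| ^ ((n : ℝ) + k + 1)) Ω) ∧
    -- the Sobolev type inequality
    (∃ c : ℝ, 0 < c ∧ ∀ u ∈ classC0 Ω,
      maFunctional Ω k u ≥ c * ∫ x in Ω, |u x| ^ ((n : ℝ) + k + 1)) ∧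
    -- the invariant is positive and gives the optimal constant
    0 < lowerLambda Ω k ∧
    (∀ c : ℝ, (∀ u ∈ classC0 Ω,
        maFunctional Ω k u ≥ c * ∫ x in Ω, |u x| ^ ((n : ℝ) + k + 1)) ↔
      (((((n : ℝ) + k + 1) * c : ℝ)) : EReal) ≤ lowerLambda Ω k) := by
  refine ⟨fun u hu => ⟨classC0.integrableOn hΩo hΩb hΩc hΩ0 hu
      (classC0.neg hn hΩo hΩb hΩc hu hΩ0) k, classC0.integrableOn_abs_rpow hΩb hu hk.le⟩,
    exists_mul_integral_abs_rpow_le_maFunctional hn hk hΩo hΩb hΩc hΩ0, ?_,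
    mul_integral_abs_rpow_le_maFunctional_iff hn hk hΩo hΩb hΩc hΩ0⟩
  obtain ⟨c, hc, h⟩ := exists_mul_integral_abs_rpow_le_maFunctional hn hk hΩo hΩb hΩc hΩ0
  exact (EReal.coe_pos.2 (mul_pos hk hc)).trans_le
    ((mul_integral_abs_rpow_le_maFunctional_iff hn hk hΩo hΩb hΩc hΩ0 c).1 h)
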